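/- For a finite simple graph $G=(V,E)$ let $\Phi_G$ be the map on subsets of $V$ that sends $S$ to the set of vertices $v$ whose closed neighbourhood ($v$ together with its neighbours) contains an odd number of elements of $S$. Subsets of $V$ form a vector space over $\mathbb{F}_2$ under symmetric difference, and $\Phi_G$ is linear. For a natural number $n$ let $d(n)=\dim_{\mathbb{F}_2}\ker\Phi_G$, where $G$ is the $n\times n$ grid graph. If $d(n)=2$, then $n\equiv -7 \pmod{12}$; equivalently, $n=2b-1$ for some odd natural number $b$ divisible by $3$. -/

import Mathlib

open Classical in
/-- The set of lights that change state when every vertex of `S` is clicked once: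
the vertices whose closed neighbourhood contains an odd number of vertices of `S`. -/
noncomputable def toggledLights {V : Type*} [Fintype V] (G : SimpleGraph V) (S : Finset V) :
    Finset V :=
  {v : V | Odd (Finset.card {w ∈ S | w = v ∨ G.Adj v w})}

open Classical in
/-- The click map on sets of vertices, as a linear map over `ZMod 2`: a set of vertices is encoded
by its `0`-`1` indicator, so that symmetric difference becomes addition. The light at `v` changes
state once for each clicked vertex in the closed neighbourhood of `v`. -/
noncomputable def clickMap {V : Type*} [Fintype V] (G : SimpleGraph V) :
    (V → ZMod 2) →ₗ[ZMod 2] (V → ZMod 2) where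
  toFun x v := ∑ w with (w = v ∨ G.Adj v w), x w
  map_add' x y := by
    funext v
    simp [Finset.sum_add_distrib]
  map_smul' c x := by
    funext v
    simp [Finset.mul_sum]

open Classical in
/-- The indicator of a set of vertices, with values in `ZMod 2`. -/
noncomputable def indicatorVec {V : Type*} (S : Finset V) : V → ZMod 2 :=
  fun v => if v ∈ S then 1 else 0

theorem indicatorVec_bijective {V : Type*} [Fintype V] :
    Function.Bijective (indicatorVec : Finset V → V → ZMod 2) := by
  classical
  constructor
  · intro S T h
    ext v
    have hv := congrFun h v
    by_cases h1 : v ∈ S <;> by_cases h2 : v ∈ T <;> simp_all [indicatorVec]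
  · intro x
    refine ⟨({v : V | x v = 1} : Finset V), ?_⟩
    funext v
    have h01 : ∀ a : ZMod 2, a = 0 ∨ a = 1 := by decide
    rcases h01 (x v) with h | h <;> simp [indicatorVec, h]

open Classical in
theorem indicatorVec_symmDiff {V : Type*} (S T : Finset V) :
    indicatorVec (symmDiff S T) = indicatorVec S + indicatorVec T := by
  have h11 : (0 : ZMod 2) = 1 + 1 := by decide
  funext v
  by_cases h1 : v ∈ S <;> by_cases h2 : v ∈ T <;>
    simp [indicatorVec, Finset.mem_symmDiff, h1, h2, h11]

/-- Under the indicator encoding, `clickMap G` is the map sending a set of clicked vertices to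
the set of lights that change state. -/
theorem clickMap_indicatorVec {V : Type*} [Fintype V] (G : SimpleGraph V) (S : Finset V) :
    clickMap G (indicatorVec S) = indicatorVec (toggledLights G S) := by
  classical
  funext v
  have h1 : clickMap G (indicatorVec S) v
      = ((Finset.card {w ∈ S | w = v ∨ G.Adj v w} : ℕ) : ZMod 2) := by
    simp only [clickMap, indicatorVec, LinearMap.coe_mk, AddHom.coe_mk, Finset.sum_boole]
    congr 2
    ext w
    simp [and_comm]
  rw [h1]
  by_cases h : Odd (Finset.card {w ∈ S | w = v ∨ G.Adj v w})
  · have h2 := (ZMod.natCast_eq_one_iff_odd).2 h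
    rw [h2]
    simp [indicatorVec, toggledLights, h]
  · have h2 := (ZMod.natCast_eq_zero_iff_even).2 (Nat.not_odd_iff_even.1 h)
    rw [h2]
    simp [indicatorVec, toggledLights, h]

/-- The nullity of a finite graph: the dimension over `ZMod 2` of the kernel of the click map. -/
noncomputable def graphNullity {V : Type*} [Fintype V] (G : SimpleGraph V) : ℕ :=
  Module.finrank (ZMod 2) (LinearMap.ker (clickMap G))

/-- The `n × n` grid graph. -/
def squareGrid (n : ℕ) : SimpleGraph (Fin n × Fin n) :=
  SimpleGraph.boxProd (SimpleGraph.pathGraph n) (SimpleGraph.pathGraph n)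

/-- The nullity `d(n)` of the `n × n` grid. -/
noncomputable def gridNullity (n : ℕ) : ℕ :=
  graphNullity (squareGrid n)

/-! In a kernel vector of the click map each column of the grid determines the next: with `A` the
path adjacency operator and zero columns placed on both sides, column `k` is `f_k(A + 1)` applied to
column 1, where `f_k` is the Fibonacci polynomial. The only remaining condition is that column `n +
1` vanishes. As `A` is cyclic with annihilator `f_(n+1)`, it follows that `d(n)` is the degree of
the gcd of `f_(n+1)(x)` and `f_(n+1)(x + 1)`.

In characteristic 2, `f_(2b+1)` is a square and `f_(2b) = x f_b ^ 2`. Common factors of the squared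
polynomial and its shift therefore enter the gcd squared, and degree 2 leaves room only for a linear
one. A linear one is impossible too: the shift swaps 0 and 1, so `x` and `x + 1` would both be
common. Hence the gcd comes from the extra factor `x`, which forces `n + 1 = 2b`, `f_b(1) = 0` (so
`3 ∣ b`) and `f_b(0) ≠ 0` (so `b` is odd). -/

open Polynomial

/-! ### Fibonacci polynomials in characteristic 2 -/

/-- The Fibonacci polynomials over `ZMod 2`. -/
noncomputable def fibPoly : ℕ → (ZMod 2)[X]
  | 0 => 0
  | 1 => 1
  | k + 2 => X * fibPoly (k + 1) + fibPoly k

theorem fibPoly_add_two (k : ℕ) : fibPoly (k + 2) = X * fibPoly (k + 1) + fibPoly k := rfl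

theorem fibPoly_add (m k : ℕ) :
    fibPoly (m + k + 1) = fibPoly (m + 1) * fibPoly (k + 1) + fibPoly m * fibPoly k := by
  induction k using Nat.twoStepInduction with
  | zero => simp [fibPoly]
  | one => rw [fibPoly_add_two]; simp [fibPoly]; ring
  | more k h0 h1 =>
    have e : fibPoly (m + (k + 2) + 1) = X * fibPoly (m + (k + 1) + 1) + fibPoly (m + k + 1) := rfl
    rw [e, h0, h1, fibPoly_add_two (k + 1), fibPoly_add_two k]
    ring

theorem fibPoly_two_mul_add_one (k : ℕ) :
    fibPoly (2 * k + 1) = (fibPoly (k + 1) + fibPoly k) ^ 2 := by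
  rw [two_mul, fibPoly_add, CharTwo.add_sq]
  ring

theorem fibPoly_two_mul (k : ℕ) : fibPoly (2 * k) = X * fibPoly k ^ 2 := by
  cases k with
  | zero => simp [fibPoly]
  | succ k =>
    have e : 2 * (k + 1) = k + (k + 1) + 1 := by ring
    rw [e, fibPoly_add, fibPoly_add_two]
    linear_combination fibPoly k * fibPoly (k + 1) * CharTwo.two_eq_zero (R := (ZMod 2)[X])

theorem fibPoly_monic_natDegree (k : ℕ) :
    (fibPoly (k + 1)).Monic ∧ (fibPoly (k + 1)).natDegree = k := by
  suffices h : ∀ k, ((fibPoly (k + 1)).Monic ∧ (fibPoly (k + 1)).degree = k) by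
    exact ⟨(h k).1, natDegree_eq_of_degree_eq_some (h k).2⟩
  intro k
  induction k using Nat.twoStepInduction with
  | zero => simp [fibPoly]
  | one => simp [fibPoly]
  | more k h0 h1 =>
    have hm : (X * fibPoly (k + 1 + 1)).Monic := monic_X.mul h1.1
    have hd : (X * fibPoly (k + 1 + 1)).degree = ((k + 2 : ℕ) : WithBot ℕ) := by
      rw [degree_mul, h1.2, degree_X, ← Nat.cast_one, ← Nat.cast_add]
      congr 1
      omega
    have hlt : (fibPoly (k + 1)).degree < (X * fibPoly (k + 1 + 1)).degree := by
      rw [hd, h0.2]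
      exact_mod_cast (by omega : k < k + 2)
    rw [fibPoly_add_two (k + 1)]
    exact ⟨hm.add_of_left hlt, (degree_add_eq_left_of_degree_lt hlt).trans hd⟩

theorem fibPoly_eval_zero_two_mul (k : ℕ) : (fibPoly (2 * k)).eval 0 = 0 := by
  simp [fibPoly_two_mul]

theorem three_dvd_of_fibPoly_eval_one {k : ℕ} (h : (fibPoly k).eval 1 = 0) : 3 ∣ k := by
  -- At 1 the values are the Fibonacci numbers mod 2, which repeat 0, 1, 1.
  have per : ∀ m, (fibPoly (3 * m)).eval 1 = 0 ∧ (fibPoly (3 * m + 1)).eval 1 = 1 := by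
    intro m
    induction m with
    | zero => simp [fibPoly]
    | succ m ih =>
      have e : 3 * (m + 1) = 3 * m + 1 + 2 := by ring
      rw [e, fibPoly_add_two (3 * m + 1 + 1), fibPoly_add_two (3 * m + 1), fibPoly_add_two (3 * m)]
      simp only [eval_add, eval_mul, eval_X, ih.1, ih.2]
      decide
  obtain ⟨m, r, hr, rfl⟩ : ∃ m r, r < 3 ∧ k = 3 * m + r :=
    ⟨k / 3, k % 3, Nat.mod_lt _ (by norm_num), (Nat.div_add_mod k 3).symm⟩
  interval_cases r
  · simp
  · simp [(per m).2] at h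
  · rw [fibPoly_add_two] at h
    simp [(per m).1, (per m).2] at h

/-! ### Paths with zero boundary values -/

/-- The entry of `g` at position `k`, counted from `1`, and `0` outside the range `1, …, n`. -/
def padded {W : Type*} [Zero W] {n : ℕ} (g : Fin n → W) (k : ℕ) : W :=
  if h : 1 ≤ k ∧ k ≤ n then g ⟨k - 1, by omega⟩ else 0

section padded

variable {W : Type*} {n : ℕ}

theorem padded_val_succ [Zero W] (g : Fin n → W) (i : Fin n) : padded g (i + 1) = g i := by
  simp [padded, Nat.succ_le_of_lt i.2]

theorem padded_zero [Zero W] (g : Fin n → W) : padded g 0 = 0 := by simp [padded]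

theorem padded_of_lt [Zero W] (g : Fin n → W) {k : ℕ} (h : n < k) : padded g k = 0 := by
  rw [padded, dif_neg (by omega)]

open Classical in
theorem sum_pathGraph_neighbors [AddCommMonoid W] (g : Fin n → W) (i : Fin n) :
    ∑ j with (SimpleGraph.pathGraph n).Adj i j, g j = padded g i + padded g (i + 2) := by
  have hsum : ∀ k : ℕ, ∑ j ∈ ({j | j.val + 1 = k} : Finset (Fin n)), g j = padded g k := by
    intro k
    by_cases h : 1 ≤ k ∧ k ≤ n
    · rw [padded, dif_pos h, Finset.sum_eq_single_of_mem ⟨k - 1, by omega⟩]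
      · simp; omega
      · intro j hj hne
        exact absurd (Fin.ext (by simp at hj ⊢; omega)) hne
    · rw [padded, dif_neg h]
      apply Finset.sum_eq_zero
      intro j hj
      simp at hj
      omega
  rw [← hsum, ← hsum, ← Finset.sum_union]
  · congr 1
    ext j
    simp [SimpleGraph.pathGraph_adj]
    omega
  · rw [Finset.disjoint_left]
    intro j
    simp
    omega

end padded

/-- The adjacency operator of the path with `n` vertices. -/
def pathAdj (n : ℕ) : Module.End (ZMod 2) (Fin n → ZMod 2) where
  toFun v i := padded v i + padded v (i + 2)
  map_add' v w := by
    funext i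
    simp only [padded, Pi.add_apply]
    split_ifs <;> ring
  map_smul' c v := by
    funext i
    simp only [padded, Pi.smul_apply, smul_eq_mul, RingHom.id_apply]
    split_ifs <;> ring

theorem pathAdj_apply {n : ℕ} (v : Fin n → ZMod 2) (i : Fin n) :
    pathAdj n v i = padded v i + padded v (i + 2) := rfl

/-- The standard basis satisfies the Fibonacci recurrence along `A`, so the first basis vector is
cyclic. -/
theorem pathAdj_padded_single {n k : ℕ} (hk : k < n) :
    pathAdj n (padded (fun i : Fin n => (Pi.single i 1 : Fin n → ZMod 2)) (k + 1)) =
      padded (fun i : Fin n => (Pi.single i 1 : Fin n → ZMod 2)) k +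
        padded (fun i : Fin n => (Pi.single i 1 : Fin n → ZMod 2)) (k + 2) := by
  have hp : ∀ (m : ℕ) (j : Fin n),
      padded (fun i : Fin n => (Pi.single i 1 : Fin n → ZMod 2)) m j =
        if (j : ℕ) + 1 = m then 1 else 0 := by
    intro m j
    unfold padded
    split_ifs with h1 h2 h2
    · simp only [Pi.single_apply]
      rw [if_pos (Fin.ext (by simp; omega))]
    · simp only [Pi.single_apply]
      rw [if_neg (fun e => h2 (by rw [e]; simp; omega))]
    · omega
    · rfl
  funext i
  have hi := i.2
  have hq : ∀ m : ℕ,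
      padded (padded (fun i : Fin n => (Pi.single i 1 : Fin n → ZMod 2)) (k + 1)) m =
        if m = k + 1 then 1 else 0 := by
    intro m
    rw [padded]
    simp only [hp]
    split_ifs <;> first | rfl | omega
  rw [pathAdj_apply, Pi.add_apply, hq, hq, hp, hp, add_comm]
  congr 1
  · exact if_congr (by omega) rfl rfl
  · exact if_congr (by omega) rfl rfl

/-! ### Linear algebra of recurrences and cyclic operators -/

/-- A sequence satisfying the Fibonacci recurrence along an endomorphism is given by the values of
the Fibonacci polynomials on its first entry. -/
theorem eq_aeval_fibPoly {V : Type*} [AddCommGroup V] [Module (ZMod 2) V]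
    (T : Module.End (ZMod 2) V) (u : ℕ → V) (n : ℕ) (h0 : u 0 = 0)
    (hu : ∀ k < n, T (u (k + 1)) = u k + u (k + 2)) :
    ∀ k ≤ n + 1, u k = aeval T (fibPoly k) (u 1) := by
  intro k
  induction k using Nat.twoStepInduction with
  | zero => simp [fibPoly, h0]
  | one => simp [fibPoly]
  | more k ih0 ih1 =>
    intro hk
    have h := hu k (by omega)
    rw [fibPoly_add_two]
    simp only [map_add, map_mul, aeval_X, LinearMap.add_apply, Module.End.mul_apply]
    rw [← ih0 (by omega), ← ih1 (by omega), h, add_right_comm, ZModModule.add_self, zero_add]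

/-- Evaluation at `e` identifies `V` with `K[X]/(f)`. The cokernel of `p(T)` is then `K[X]/(f, p)`,
and kernel and cokernel have equal dimension. -/
theorem finrank_ker_aeval_of_cyclic {K V : Type*} [Field K] [DecidableEq K[X]] [AddCommGroup V]
    [Module K V] [FiniteDimensional K V] (T : Module.End K V) (e : V)
    (he : ∀ v, ∃ q : K[X], aeval T q e = v) {f : K[X]} (hf : f ≠ 0) (hfe : aeval T f e = 0)
    (hdeg : f.natDegree = Module.finrank K V) (p : K[X]) :
    Module.finrank K (LinearMap.ker (aeval T p)) = (EuclideanDomain.gcd f p).natDegree := by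
  let φ : K[X] →ₗ[K] V := (LinearMap.applyₗ e).comp (aeval T).toLinearMap
  have hφ : ∀ q, φ q = aeval T q e := fun q => rfl
  let J : Submodule K K[X] := (Ideal.span {f}).restrictScalars K
  have hJ : J ≤ LinearMap.ker φ := by
    intro q hq
    obtain ⟨r, rfl⟩ := Ideal.mem_span_singleton'.1 hq
    simp [hφ, hfe]
  have hfin : Module.finrank K (K[X] ⧸ J) = Module.finrank K V := by
    rw [← hdeg]
    exact finrank_quotient_span_eq_natDegree (f := f)
  have : FiniteDimensional K (K[X] ⧸ J) := by
    have : FiniteDimensional K (AdjoinRoot f) := (AdjoinRoot.powerBasis hf).finite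
    exact this
  have hsurj : Function.Surjective (J.liftQ φ hJ) := by
    intro v
    obtain ⟨q, hq⟩ := he v
    exact ⟨J.mkQ q, hq⟩
  have hinj := (LinearMap.injective_iff_surjective_of_finrank_eq_finrank hfin).2 hsurj
  have hker : ∀ q, aeval T q e = 0 → f ∣ q := by
    intro q hq
    have h1 : J.mkQ q = 0 := hinj (by rw [map_zero]; exact hq)
    exact Ideal.mem_span_singleton.1 ((Submodule.Quotient.mk_eq_zero J).1 h1)
  let W := LinearMap.range (aeval T p)
  let ψ : K[X] →ₗ[K] V ⧸ W := W.mkQ.comp φ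
  have hψ : Function.Surjective ψ := W.mkQ_surjective.comp he
  have hψker : LinearMap.ker ψ = (Ideal.span {EuclideanDomain.gcd f p}).restrictScalars K := by
    ext q
    rw [EuclideanDomain.span_gcd, Submodule.restrictScalars_mem, LinearMap.mem_ker,
      Ideal.mem_span_pair]
    have h1 : ψ q = 0 ↔ ∃ v, aeval T p v = aeval T q e := Submodule.Quotient.mk_eq_zero W
    rw [h1]
    constructor
    · rintro ⟨v, hv⟩
      obtain ⟨r, rfl⟩ := he v
      obtain ⟨s, hs⟩ := hker (q - p * r) (by simp [hv])
      exact ⟨s, r, by linear_combination -hs⟩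
    · rintro ⟨a, b, rfl⟩
      refine ⟨aeval T b e, ?_⟩
      simp only [map_add, map_mul, LinearMap.add_apply, Module.End.mul_apply, hfe, map_zero,
        zero_add]
      simp only [← Module.End.mul_apply, ← map_mul, mul_comm]
  have h1 : Module.finrank K (V ⧸ W) = (EuclideanDomain.gcd f p).natDegree := by
    rw [← (ψ.quotKerEquivOfSurjective hψ).finrank_eq, hψker]
    exact finrank_quotient_span_eq_natDegree
  have h2 := LinearMap.finrank_range_add_finrank_ker (aeval T p)
  have h3 := W.finrank_quotient_add_finrank
  change Module.finrank K W + _ = _ at h2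
  omega

/-! ### Grid nullity as the degree of a gcd -/

theorem clickMap_squareGrid_apply {n : ℕ} (x : Fin n × Fin n → ZMod 2) (i j : Fin n) :
    clickMap (squareGrid n) x (i, j) =
      ((pathAdj n + 1) (fun i => x (i, j)) + padded (fun j i => x (i, j)) j +
        padded (fun j i => x (i, j)) (j + 2)) i := by
  classical
  have hp : ∀ k, padded (fun j i => x (i, j)) k i = padded (fun j => x (i, j)) k := by
    intro k
    unfold padded
    split_ifs <;> rfl
  simp only [Pi.add_apply, LinearMap.add_apply, Module.End.one_apply, pathAdj_apply, hp]
  rw [add_assoc, ← sum_pathGraph_neighbors, ← sum_pathGraph_neighbors]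
  rw [show clickMap (squareGrid n) x (i, j) =
      ∑ w with (w = (i, j) ∨ (squareGrid n).Adj (i, j) w), x w from
    Finset.sum_congr (by ext w; simp) fun _ _ => rfl]
  have hset : ({w | w = (i, j) ∨ (squareGrid n).Adj (i, j) w} : Finset (Fin n × Fin n)) =
      ((({i' | (SimpleGraph.pathGraph n).Adj i i'} : Finset (Fin n)) ×ˢ {j}) ∪ {(i, j)}) ∪
        ({i} ×ˢ ({j' | (SimpleGraph.pathGraph n).Adj j j'} : Finset (Fin n))) := by
    ext ⟨a, b⟩
    simp [squareGrid, SimpleGraph.boxProd_adj]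
  rw [hset, Finset.sum_union, Finset.sum_union, Finset.sum_product, Finset.sum_product]
  · simp
  · simp
  · rw [Finset.disjoint_left]
    rintro ⟨a, b⟩
    simp
    rintro h hb rfl
    rcases h with ⟨-, rfl⟩ | ⟨-, rfl⟩ <;> exact hb.ne rfl

theorem gridNullity_eq_finrank_ker (n : ℕ) :
    gridNullity n =
      Module.finrank (ZMod 2) (LinearMap.ker (aeval (pathAdj n + 1) (fibPoly (n + 1)))) := by
  set B : Module.End (ZMod 2) (Fin n → ZMod 2) := pathAdj n + 1 with hB
  have hrec : ∀ x, clickMap (squareGrid n) x = 0 ↔ ∀ k < n,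
      B (padded (fun j i => x (i, j)) (k + 1)) =
        padded (fun j i => x (i, j)) k + padded (fun j i => x (i, j)) (k + 2) := by
    intro x
    have key : ∀ j : Fin n, B (padded (fun j i => x (i, j)) (j + 1)) =
        padded (fun j i => x (i, j)) j + padded (fun j i => x (i, j)) (j + 2) ↔
          ∀ i, clickMap (squareGrid n) x (i, j) = 0 := by
      intro j
      simp only [clickMap_squareGrid_apply, padded_val_succ]
      rw [add_assoc, ← hB, ← sub_eq_zero, ZModModule.sub_eq_add, funext_iff]
      rfl
    constructor
    · intro h k hk
      exact (key ⟨k, hk⟩).2 fun i => by rw [h]; rfl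
    · intro h
      funext ⟨i, j⟩
      exact (key j).1 (h j j.2) i
  -- Rebuild the whole grid from its first column.
  let ι : (Fin n → ZMod 2) →ₗ[ZMod 2] (Fin n × Fin n → ZMod 2) :=
    { toFun := fun v w => aeval B (fibPoly (w.2 + 1)) v w.1
      map_add' := fun v v' => by funext w; simp
      map_smul' := fun c v => by funext w; simp }
  have hι : ∀ v, aeval B (fibPoly (n + 1)) v = 0 → ∀ k ≤ n + 1,
      padded (fun j i => ι v (i, j)) k = aeval B (fibPoly k) v := by
    intro v hv k hk
    rcases Nat.eq_zero_or_pos k with rfl | hk0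
    · simp [padded_zero, fibPoly]
    rcases Nat.lt_or_ge n k with h | h
    · obtain rfl : k = n + 1 := by omega
      rw [hv, padded_of_lt _ h]
    · obtain ⟨m, rfl⟩ : ∃ m, k = m + 1 := ⟨k - 1, by omega⟩
      exact padded_val_succ (fun j i => ι v (i, j)) ⟨m, h⟩
  have hmem : ∀ v, v ∈ LinearMap.ker (aeval B (fibPoly (n + 1))) →
      ι v ∈ LinearMap.ker (clickMap (squareGrid n)) := by
    intro v hv
    rw [LinearMap.mem_ker] at hv ⊢
    rw [hrec]
    intro k hk
    rw [hι v hv _ (by omega), hι v hv _ (by omega), hι v hv _ (by omega), fibPoly_add_two]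
    simp only [map_add, map_mul, aeval_X, LinearMap.add_apply, Module.End.mul_apply]
    rw [add_left_comm, ZModModule.add_self, add_zero]
  refine (LinearEquiv.finrank_eq (LinearEquiv.ofBijective (ι.restrict hmem) ⟨?_, ?_⟩)).symm
  · rw [← LinearMap.ker_eq_bot, LinearMap.ker_eq_bot']
    rintro ⟨v, hv⟩ h
    have h' : ι v = 0 := congrArg Subtype.val h
    ext i
    have := congrFun h' (i, ⟨0, i.pos⟩)
    simpa [ι, fibPoly] using this
  · rintro ⟨x, hx⟩
    have hx' := (hrec x).1 hx
    have hu := eq_aeval_fibPoly B _ n (padded_zero _) hx'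
    refine ⟨⟨padded (fun j i => x (i, j)) 1, ?_⟩, ?_⟩
    · rw [LinearMap.mem_ker, ← hu _ le_rfl, padded_of_lt _ (by omega)]
    · apply Subtype.ext
      funext ⟨i, j⟩
      change aeval B (fibPoly (j + 1)) _ i = _
      exact (congrFun (hu (j + 1) (by omega)) i).symm.trans
        (congrFun (padded_val_succ (fun j i => x (i, j)) j) i)

theorem gridNullity_eq_natDegree_gcd [DecidableEq (ZMod 2)[X]] (n : ℕ) :
    gridNullity n = (EuclideanDomain.gcd (fibPoly (n + 1))
      ((fibPoly (n + 1)).comp (X + 1))).natDegree := by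
  rw [gridNullity_eq_finrank_ker]
  have hcomp : aeval (pathAdj n + 1) (fibPoly (n + 1)) =
      aeval (pathAdj n) ((fibPoly (n + 1)).comp (X + 1)) := by
    rw [aeval_comp]
    simp
  rw [hcomp]
  set E : Fin n → Fin n → ZMod 2 := fun i => Pi.single i 1 with hE
  have hu := eq_aeval_fibPoly (pathAdj n) (padded E) n (padded_zero _)
    fun k hk => pathAdj_padded_single hk
  apply finrank_ker_aeval_of_cyclic (pathAdj n) (padded E 1)
  · intro v
    -- `f_(i+1)(A)` sends the first basis vector to the one with 0-based index `i`.
    refine ⟨∑ i, C (v i) * fibPoly (i + 1), ?_⟩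
    simp only [map_sum, map_mul, aeval_C, LinearMap.sum_apply, Module.End.mul_apply,
      Module.algebraMap_end_apply]
    have : ∀ i : Fin n, aeval (pathAdj n) (fibPoly (i + 1)) (padded E 1) = E i := fun i => by
      rw [← hu _ (by omega), padded_val_succ]
    simp only [this]
    exact (pi_eq_sum_univ' v).symm
  · exact (fibPoly_monic_natDegree n).1.ne_zero
  · rw [← hu _ le_rfl, padded_of_lt _ (by omega)]
  · rw [(fibPoly_monic_natDegree n).2]
    simp

/-! ### Common factors of a polynomial and its shift -/

/-- If `d` is a common divisor of `p` and its shift that has a root, then both `0` and `1` are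
roots of `p`. -/
theorem eval_zero_one_of_root {p d : (ZMod 2)[X]} (h1 : d ∣ p) (h2 : d ∣ p.comp (X + 1))
    {a : ZMod 2} (ha : d.IsRoot a) : p.eval 0 = 0 ∧ p.eval 1 = 0 := by
  have e1 : p.eval a = 0 := ha.dvd h1
  have e2 : p.eval (a + 1) = 0 := by simpa using (ha.dvd h2 : eval a (p.comp (X + 1)) = 0)
  have h01 : a = 0 ∨ a = 1 := by
    clear ha e1 e2
    revert a
    decide
  rcases h01 with rfl | rfl
  · exact ⟨e1, by simpa using e2⟩
  · exact ⟨by simpa [CharTwo.add_self_eq_zero] using e2, e1⟩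

theorem X_mul_X_add_one_dvd {p : (ZMod 2)[X]} (h0 : p.eval 0 = 0) (h1 : p.eval 1 = 0) :
    X * (X + 1) ∣ p := by
  have c : IsCoprime (X : (ZMod 2)[X]) (X + 1) := ⟨-1, 1, by ring⟩
  refine c.mul_dvd (by simpa using dvd_iff_isRoot.2 h0) ?_
  have := dvd_iff_isRoot.2 (show p.IsRoot 1 from h1)
  rwa [CharTwo.sub_eq_add, map_one] at this

theorem X_mul_X_add_one_dvd_comp {p : (ZMod 2)[X]} (h0 : p.eval 0 = 0) (h1 : p.eval 1 = 0) :
    X * (X + 1) ∣ p.comp (X + 1) :=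
  X_mul_X_add_one_dvd (by simpa using h1) (by simpa [CharTwo.add_self_eq_zero] using h0)

theorem natDegree_X_mul_X_add_one : (X * (X + 1) : (ZMod 2)[X]).natDegree = 2 := by
  compute_degree!

/-- If the squares of `p` and of its shift have common factors of total degree at most `2`, then
`p` and its shift are coprime. -/
theorem isCoprime_comp_of_natDegree_le [DecidableEq (ZMod 2)[X]] {p g : (ZMod 2)[X]} (hg : g ≠ 0)
    (hdeg : g.natDegree ≤ 2)
    (h : ∀ d, d ∣ p → d ∣ p.comp (X + 1) → d ^ 2 ∣ g) : IsCoprime p (p.comp (X + 1)) := by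
  set d := EuclideanDomain.gcd p (p.comp (X + 1)) with hd
  have hdp := EuclideanDomain.gcd_dvd_left p (p.comp (X + 1))
  have hdq := EuclideanDomain.gcd_dvd_right p (p.comp (X + 1))
  rw [← hd] at hdp hdq
  have hdg := h d hdp hdq
  have hd0 : d ≠ 0 := by
    rintro h0
    rw [h0] at hdg
    exact hg (by simpa using hdg)
  have hle := natDegree_le_of_dvd hdg hg
  rw [natDegree_pow] at hle
  rcases (by omega : d.natDegree = 0 ∨ d.natDegree = 1) with h0 | h1
  · rw [← EuclideanDomain.gcd_isUnit_iff]
    exact isUnit_iff_degree_eq_zero.2 (by rw [degree_eq_natDegree hd0]; exact_mod_cast h0)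
  · obtain ⟨a, ha⟩ := exists_root_of_degree_eq_one
      (show d.degree = 1 by rw [degree_eq_natDegree hd0]; exact_mod_cast h1)
    obtain ⟨e0, e1⟩ := eval_zero_one_of_root hdp hdq ha
    have hdvd : X * (X + 1) ∣ d :=
      EuclideanDomain.dvd_gcd (X_mul_X_add_one_dvd e0 e1) (X_mul_X_add_one_dvd_comp e0 e1)
    have := natDegree_le_of_dvd hdvd hd0
    rw [natDegree_X_mul_X_add_one] at this
    omega

theorem not_isCoprime_of_natDegree_gcd [DecidableEq (ZMod 2)[X]] {p q : (ZMod 2)[X]}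
    (h : (EuclideanDomain.gcd p q).natDegree = 2) : ¬ IsCoprime p q := by
  intro hc
  have := natDegree_eq_zero_of_isUnit (EuclideanDomain.gcd_isUnit_iff.2 hc)
  omega

theorem fibPoly_gcd_natDegree_two [DecidableEq (ZMod 2)[X]] {N : ℕ}
    (h : (EuclideanDomain.gcd (fibPoly N) ((fibPoly N).comp (X + 1))).natDegree = 2) :
    ∃ b, N = 2 * b ∧ Odd b ∧ 3 ∣ b := by
  set g := EuclideanDomain.gcd (fibPoly N) ((fibPoly N).comp (X + 1)) with hg
  have hg0 : g ≠ 0 := by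
    rintro h0
    simp [h0] at h
  have hcop := not_isCoprime_of_natDegree_gcd h
  rcases Nat.even_or_odd' N with ⟨b, rfl | rfl⟩
  · refine ⟨b, rfl, ?_⟩
    have hN := fibPoly_two_mul b
    set p := fibPoly b with hp
    have hNc : (fibPoly (2 * b)).comp (X + 1) = (X + 1) * p.comp (X + 1) ^ 2 := by
      simp [hN]
    have hpq : IsCoprime p (p.comp (X + 1)) := by
      apply isCoprime_comp_of_natDegree_le hg0 h.le
      intro d h1 h2
      apply EuclideanDomain.dvd_gcd
      · rw [hN]
        exact (pow_dvd_pow_of_dvd h1 2).mul_left _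
      · rw [hNc]
        exact (pow_dvd_pow_of_dvd h2 2).mul_left _
    -- Otherwise `x` and `p ^ 2` are each coprime to `x + 1` and to the square of the shifted `p`,
    -- making the gcd trivial.
    have h1 : p.eval 1 = 0 := by
      by_contra h1
      have h1' : ¬ (X + 1 : (ZMod 2)[X]) ∣ p := by
        intro hdvd
        apply h1
        have := (show (X + 1 : (ZMod 2)[X]).IsRoot 1 by
          simp [IsRoot, CharTwo.add_self_eq_zero]).dvd hdvd
        exact this
      have h0' : ¬ (X : (ZMod 2)[X]) ∣ p.comp (X + 1) := by
        intro hdvd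
        apply h1
        simpa using (show (X : (ZMod 2)[X]).IsRoot 0 by simp).dvd hdvd
      have irr : Irreducible (X + 1 : (ZMod 2)[X]) := by
        simpa [CharTwo.sub_eq_add] using irreducible_X_sub_C (1 : ZMod 2)
      apply hcop
      rw [hNc, hN]
      refine IsCoprime.mul_left (IsCoprime.mul_right ⟨-1, 1, by ring⟩ ?_)
        (IsCoprime.mul_right ?_ hpq.pow)
      · exact (irreducible_X.coprime_iff_not_dvd.2 h0').pow_right
      · exact (irr.coprime_iff_not_dvd.2 h1').symm.pow_left
    refine ⟨?_, three_dvd_of_fibPoly_eval_one h1⟩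
    rw [← Nat.not_even_iff_odd]
    rintro hb
    obtain ⟨c, rfl⟩ := hb.two_dvd
    -- With both 0 and 1 as roots, `p` and its shift would share `x (x + 1)`, against `hpq`.
    have h0 : p.eval 0 = 0 := fibPoly_eval_zero_two_mul c
    have := natDegree_eq_zero_of_isUnit
      (hpq.isUnit_of_dvd' (X_mul_X_add_one_dvd h0 h1) (X_mul_X_add_one_dvd_comp h0 h1))
    rw [natDegree_X_mul_X_add_one] at this
    omega
  · exfalso
    have hN := fibPoly_two_mul_add_one b
    set p := fibPoly (b + 1) + fibPoly b with hp
    have hNc : (fibPoly (2 * b + 1)).comp (X + 1) = p.comp (X + 1) ^ 2 := by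
      rw [hN, pow_comp]
    have hpq : IsCoprime p (p.comp (X + 1)) := by
      apply isCoprime_comp_of_natDegree_le hg0 h.le
      intro d h1 h2
      apply EuclideanDomain.dvd_gcd
      · rw [hN]
        exact pow_dvd_pow_of_dvd h1 2
      · rw [hNc]
        exact pow_dvd_pow_of_dvd h2 2
    apply hcop
    rw [hNc, hN]
    exact hpq.pow

theorem corollary5 (n : ℕ) (hn : gridNullity n = 2) :
    (n : ℤ) ≡ -7 [ZMOD 12] ∧ ∃ b : ℕ, Odd b ∧ 3 ∣ b ∧ (n : ℤ) = 2 * (b : ℤ) - 1 := by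
  classical
  rw [gridNullity_eq_natDegree_gcd] at hn
  obtain ⟨b, hb, hodd, h3⟩ := fibPoly_gcd_natDegree_two hn
  refine ⟨?_, b, hodd, h3, by omega⟩
  obtain ⟨c, rfl⟩ := hodd
  unfold Int.ModEq
  omega
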